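/- Let $(\mathcal E,\mathsf{first},\mathsf{second})$ be a finite directed multigraph (parallel edges and loops allowed) whose vertex set $\mathcal V$ consists of the endpoints of its edges. Let $u:\mathcal E\to[0,\infty]$ be capacities, $c:\mathcal E\to\mathbb R$ costs and $b:\mathcal V\to\mathbb R$ balances. A flow $f:\mathcal E\to[0,\infty)$ is feasible if $f(e)\le u(e)$ for all $e\in\mathcal E$ and $$\sum_{e:\ \mathsf{first}(e)=v} f(e)-\sum_{e:\ \mathsf{second}(e)=v} f(e)=b(v)\qquad\text{for all } v\in\mathcal V .$$ Its cost is $c(f)=\sum_{e\in\mathcal E} f(e)\,c(e)$, and an optimum solution is a feasible flow of least cost. A cycle is a non-empty sequence $e_1,\dots,e_k$ of edges, repetitions allowed, with $\mathsf{second}(e_i)=\mathsf{first}(e_{i+1})$ for $i<k$ and $\mathsf{second}(e_k)=\mathsf{first}(e_1)$; its cost is $\sum_{i=1}^k c(e_i)$. Suppose that the problem has a feasible flow. Then it has an optimum solution if and only if there is no cycle of negative cost all of whose edges have infinite capacity. Moreover, if there is such a cycle, then for every $K\in\mathbb R$ there is a feasible flow of cost less than $K$. -/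

import Mathlib

open scoped NNReal ENNReal

/-- A finite directed multigraph: a finite set of edges together with two functions giving
the endpoints of each edge. Parallel edges and loops are allowed. -/
structure DiMultigraph (V E : Type*) where
  edges : Finset E
  first : E → V
  second : E → V

namespace DiMultigraph

variable {V E : Type*} (G : DiMultigraph V E)

/-- The vertices of the multigraph are the endpoints of its edges. -/
def vertices : Set V := {v | ∃ e ∈ G.edges, G.first e = v ∨ G.second e = v}

open Classical in
/-- The set `δ⁺(v)` of edges leaving `v`. -/
noncomputable def deltaPlus (v : V) : Finset E := G.edges.filter (fun e => G.first e = v)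

open Classical in
/-- The set `δ⁻(v)` of edges entering `v`. -/
noncomputable def deltaMinus (v : V) : Finset E := G.edges.filter (fun e => G.second e = v)

/-- A path over edges: a non-empty sequence of edges of the graph in which each edge starts
where the previous one ends. -/
def IsPath (p : List E) : Prop :=
  p ≠ [] ∧ (∀ e ∈ p, e ∈ G.edges) ∧ p.IsChain (fun e e' => G.second e = G.first e')

/-- A cycle: a path whose source and target are identical. -/
def IsCycle (p : List E) : Prop :=
  G.IsPath p ∧ ∃ h : p ≠ [], G.first (p.head h) = G.second (p.getLast h)

end DiMultigraph

/-- A minimum-cost flow problem: a directed multigraph with capacities in `[0, ∞]`,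
real balances and real costs. -/
structure MinCostFlowProblem (V E : Type*) extends DiMultigraph V E where
  cap : E → ℝ≥0∞
  balance : V → ℝ
  cost : E → ℝ

namespace MinCostFlowProblem

variable {V E : Type*} (P : MinCostFlowProblem V E)

/-- The excess at `v`: ingoing flow minus outgoing flow. -/
noncomputable def excess (f : E → ℝ≥0) (v : V) : ℝ :=
  ∑ e ∈ P.deltaMinus v, (f e : ℝ) - ∑ e ∈ P.deltaPlus v, (f e : ℝ)

/-- A feasible flow: it satisfies the capacity and the balance constraints. -/
def IsFeasible (f : E → ℝ≥0) : Prop :=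
  (∀ e ∈ P.edges, (f e : ℝ≥0∞) ≤ P.cap e) ∧ ∀ v ∈ P.vertices, -P.excess f v = P.balance v

/-- The total costs of a flow. -/
noncomputable def totalCost (f : E → ℝ≥0) : ℝ := ∑ e ∈ P.edges, (f e : ℝ) * P.cost e

/-- An optimum solution (minimum-cost flow): a feasible flow of least total costs. -/
def IsOptimal (f : E → ℝ≥0) : Prop :=
  P.IsFeasible f ∧ ∀ g : E → ℝ≥0, P.IsFeasible g → P.totalCost f ≤ P.totalCost g

/-- The costs of a sequence of edges, accumulated along the sequence (with multiplicity). -/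
def seqCost (p : List E) : ℝ := (p.map P.cost).sum

/-- A cycle of negative total costs all of whose edges have infinite capacity. -/
def IsNegInftyCycle (C : List E) : Prop :=
  P.IsCycle C ∧ (∀ e ∈ C, P.cap e = ∞) ∧ P.seqCost C < 0

end MinCostFlowProblem

/-!
If `C` is a cycle of infinite-capacity edges, adding `t` times the multiplicity function
`e ↦ count e C` to a flow keeps the balances (`IsCycle.sum_count_deltaMinus`), and changes the cost
by `t` times the cost of `C`. With `t → ∞` along a cycle of negative cost, the cost is unbounded
below, so no optimum exists.

Conversely, suppose that no infinite-capacity cycle has negative cost. Subtracting from a feasible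
flow as large a multiple as possible of a cycle of infinite-capacity edges carrying flow does not
increase the cost, and annihilates the flow on one more edge. So every feasible flow can be
replaced by one that is no more expensive and for which no such cycle is left
(`exists_feasible_noFlowCycle`). In such a flow the value on an infinite-capacity edge from `x` to
`y` is bounded by a cut argument: let `S` be the set of vertices from which `x` is reachable along
infinite-capacity edges carrying flow. No such edge enters `S`, and `y ∉ S`, so the flow on the
edge is at most the sum of the balances on `S` plus what enters `S` on edges of finite capacity
(`IsFeasible.le_flowBound`). Hence it suffices to minimise the cost over the feasible flows with
values in a fixed bounded interval, which form a compact set.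
-/

/-! ### Multiplicities along a cycle -/

namespace DiMultigraph

variable {V E : Type*} {G : DiMultigraph V E}

theorem map_first_append_getLast_of_isChain (p : List E) (hne : p ≠ [])
    (hp : p.IsChain (fun e e' => G.second e = G.first e')) :
    p.map G.first ++ [G.second (p.getLast hne)] = G.first (p.head hne) :: p.map G.second := by
  induction p with
  | nil => exact absurd rfl hne
  | cons a l ih =>
    cases l with
    | nil => simp
    | cons b l =>
      rw [List.isChain_cons_cons] at hp
      have h := ih (by simp) hp.2
      simp only [List.map_cons, List.head_cons, List.cons_append] at h ⊢
      rw [List.getLast_cons (by simp), h, hp.1]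

theorem IsCycle.map_first_perm {p : List E} (hp : G.IsCycle p) :
    (p.map G.first).Perm (p.map G.second) := by
  obtain ⟨⟨-, -, hc⟩, hne, hcl⟩ := hp
  have h := map_first_append_getLast_of_isChain p hne hc
  rw [hcl] at h
  exact (List.perm_cons _).1 ((List.perm_append_singleton _ _).symm.trans (List.Perm.of_eq h))

open Classical in
theorem sum_filter_count_eq (s : Finset E) (h : E → V) (v : V) (p : List E)
    (hp : ∀ e ∈ p, e ∈ s) :
    ∑ e ∈ s with h e = v, p.count e = (p.map h).count v := by
  induction p with
  | nil => simp
  | cons a l ih =>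
    have ha : a ∈ s := hp a (by simp)
    simp only [List.count_cons, List.map_cons, Finset.sum_add_distrib,
      ih fun e he => hp e (by simp [he]), beq_iff_eq]
    simp [ha]

open Classical in
/-- The multiplicity function of a cycle is a circulation. -/
theorem IsCycle.sum_count_deltaMinus {p : List E} (hp : G.IsCycle p) (v : V) :
    ∑ e ∈ G.deltaMinus v, p.count e = ∑ e ∈ G.deltaPlus v, p.count e := by
  unfold deltaMinus deltaPlus
  rw [sum_filter_count_eq _ _ _ _ hp.1.2.1, sum_filter_count_eq _ _ _ _ hp.1.2.1,
    hp.map_first_perm.count_eq]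

/-- Reachability of `z` from the end of `e₀` along edges satisfying `Q` yields an explicit path from
the start of `e₀` to `z`; starting with `e₀` keeps it non-empty. -/
theorem exists_isPath_of_reflTransGen {Q : E → Prop} {e₀ : E} (he₀ : e₀ ∈ G.edges) (hQ : Q e₀)
    {z : V}
    (h : Relation.ReflTransGen
      (fun a b => ∃ e ∈ G.edges, Q e ∧ G.first e = a ∧ G.second e = b) (G.second e₀) z) :
    ∃ p : List E, G.IsPath p ∧ (∀ e ∈ p, Q e) ∧
      ∃ hne : p ≠ [], G.first (p.head hne) = G.first e₀ ∧ G.second (p.getLast hne) = z := by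
  induction h with
  | refl => exact ⟨[e₀], by simp [IsPath, he₀], by simpa using hQ, by simp, rfl, rfl⟩
  | tail _ hstep ih =>
    obtain ⟨p, ⟨-, hmem, hc⟩, hpQ, hne, hhead, hlast⟩ := ih
    obtain ⟨e, he, heQ, rfl, rfl⟩ := hstep
    refine ⟨p ++ [e], ⟨by simp, ?_, ?_⟩, ?_, by simp, ?_, by simp⟩
    · simp only [List.mem_append, List.mem_singleton]
      rintro x (hx | rfl)
      exacts [hmem x hx, he]
    · refine List.isChain_append.2 ⟨hc, by simp, ?_⟩
      intro x hx y hy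
      rw [List.getLast?_eq_getLast_of_ne_nil hne] at hx
      simp only [Option.mem_def, Option.some.injEq, List.head?_cons] at hx hy
      rw [← hx, ← hy, hlast]
    · simp only [List.mem_append, List.mem_singleton]
      rintro x (hx | rfl)
      exacts [hpQ x hx, heQ]
    · rw [List.head_append_of_ne_nil hne, hhead]

end DiMultigraph

namespace MinCostFlowProblem

variable {V E : Type*} {P : MinCostFlowProblem V E}

/-! ### Changing a flow along a cycle -/

open Classical in
theorem IsFeasible.congr {f g : E → ℝ≥0} (hf : P.IsFeasible f) (h : ∀ e ∈ P.edges, g e = f e) :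
    P.IsFeasible g := by
  refine ⟨fun e he => h e he ▸ hf.1 e he, fun v hv => ?_⟩
  rw [← hf.2 v hv]
  unfold excess
  congr 2 <;> refine Finset.sum_congr rfl fun e he => ?_ <;>
    rw [h e (Finset.filter_subset _ _ he)]

open Classical in
theorem IsFeasible.of_add_count {f g : E → ℝ≥0} (hf : P.IsFeasible f) {C : List E}
    (hC : P.IsCycle C) (hcap : ∀ e ∈ C, P.cap e = ∞) (t : ℝ)
    (hg : ∀ e, (g e : ℝ) = f e + t * C.count e) : P.IsFeasible g := by
  refine ⟨fun e he => ?_, fun v hv => ?_⟩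
  · by_cases h : e ∈ C
    · simp [hcap e h]
    · have : g e = f e := by
        have := hg e
        rw [List.count_eq_zero_of_not_mem h] at this
        exact NNReal.coe_injective (by simpa using this)
      exact this ▸ hf.1 e he
  · have hb := congrArg (Nat.cast (R := ℝ)) (hC.sum_count_deltaMinus v)
    push_cast at hb
    rw [← hf.2 v hv]
    simp only [excess, hg, Finset.sum_add_distrib, ← Finset.mul_sum, hb]
    ring

open Classical in
theorem seqCost_eq_sum_count {C : List E} (hC : ∀ e ∈ C, e ∈ P.edges) :
    P.seqCost C = ∑ e ∈ P.edges, (C.count e : ℝ) * P.cost e := by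
  rw [seqCost, Finset.sum_list_map_count]
  simp only [nsmul_eq_mul]
  refine Finset.sum_subset (fun e he => hC e (List.mem_toFinset.1 he)) fun e _ he => ?_
  rw [List.count_eq_zero_of_not_mem (by simpa using he)]
  simp

open Classical in
theorem totalCost_of_add_count {f g : E → ℝ≥0} {C : List E}
    (hC : ∀ e ∈ C, e ∈ P.edges) (t : ℝ) (hg : ∀ e, (g e : ℝ) = f e + t * C.count e) :
    P.totalCost g = P.totalCost f + t * P.seqCost C := by
  rw [seqCost_eq_sum_count hC, totalCost, totalCost, Finset.mul_sum, ← Finset.sum_add_distrib]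
  refine Finset.sum_congr rfl fun e _ => ?_
  rw [hg]
  ring

theorem exists_totalCost_lt {C : List E} (hC : P.IsNegInftyCycle C) {f : E → ℝ≥0}
    (hf : P.IsFeasible f) (K : ℝ) : ∃ g : E → ℝ≥0, P.IsFeasible g ∧ P.totalCost g < K := by
  classical
  obtain ⟨hcyc, hcap, hneg⟩ := hC
  obtain ⟨n, hn⟩ := exists_nat_gt ((P.totalCost f - K) / -P.seqCost C)
  have hg : ∀ e, ((f e + n * C.count e : ℝ≥0) : ℝ) = f e + (n : ℝ) * C.count e := by simp
  refine ⟨_, hf.of_add_count hcyc hcap n hg, ?_⟩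
  rw [totalCost_of_add_count hcyc.1.2.1 n hg]
  rw [div_lt_iff₀ (by linarith)] at hn
  linarith

/-! ### Cancelling cycles that carry flow -/

/-- No cycle of infinite-capacity edges carries a positive flow on each of its edges. -/
def NoFlowCycle (P : MinCostFlowProblem V E) (f : E → ℝ≥0) : Prop :=
  ∀ C : List E, P.IsCycle C → ¬ ∀ e ∈ C, P.cap e = ∞ ∧ 0 < f e

open Classical in
/-- The infinite-capacity edges on which the flow is positive. -/
noncomputable def inftySupport (P : MinCostFlowProblem V E) (f : E → ℝ≥0) : Finset E :=
  {e ∈ P.edges | P.cap e = ∞ ∧ 0 < f e}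

/-- Cancelling a cycle: it loses flow at no extra cost, until one of its edges carries none. -/
theorem exists_inftySupport_ssubset (hno : ¬ ∃ C : List E, P.IsNegInftyCycle C) {f : E → ℝ≥0}
    (hf : P.IsFeasible f) {C : List E} (hC : P.IsCycle C)
    (hpos : ∀ e ∈ C, P.cap e = ∞ ∧ 0 < f e) :
    ∃ g : E → ℝ≥0, P.IsFeasible g ∧ P.totalCost g ≤ P.totalCost f ∧
      P.inftySupport g ⊂ P.inftySupport f := by
  classical
  have hmem := hC.1.2.1
  -- The largest multiple of `C` that can be subtracted is determined by the edge `e₀`.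
  obtain ⟨e₀, he₀, hmin⟩ := C.toFinset.exists_min_image (fun e => f e / C.count e)
    (List.toFinset_nonempty_iff C |>.2 hC.1.1)
  rw [List.mem_toFinset] at he₀
  set t : ℝ≥0 := f e₀ / C.count e₀ with ht
  have hcount : ∀ e ∈ C, (0 : ℝ≥0) < C.count e := fun e he => by
    exact_mod_cast List.count_pos_iff.2 he
  have hle : ∀ e, t * C.count e ≤ f e := fun e => by
    by_cases he : e ∈ C
    · exact (le_div_iff₀ (hcount e he)).1 (hmin e (List.mem_toFinset.2 he))
    · simp [List.count_eq_zero_of_not_mem he]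
  have hg : ∀ e, ((f e - t * C.count e : ℝ≥0) : ℝ) = f e + (-t : ℝ) * C.count e := fun e => by
    rw [NNReal.coe_sub (hle e)]
    push_cast
    ring
  refine ⟨_, hf.of_add_count hC (fun e he => (hpos e he).1) (-t) hg, ?_, ?_⟩
  · rw [totalCost_of_add_count hmem (-t) hg]
    have hcost : 0 ≤ P.seqCost C := by
      by_contra h
      exact hno ⟨C, hC, fun e he => (hpos e he).1, not_le.1 h⟩
    nlinarith [mul_nonneg t.coe_nonneg hcost]
  · refine Finset.ssubset_iff_of_subset (fun e he => ?_) |>.2 ⟨e₀, ?_, ?_⟩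
    · simp only [inftySupport, Finset.mem_filter] at he ⊢
      exact ⟨he.1, he.2.1, he.2.2.trans_le tsub_le_self⟩
    · simp only [inftySupport, Finset.mem_filter]
      exact ⟨hmem e₀ he₀, hpos e₀ he₀⟩
    · simp [inftySupport, ht, div_mul_cancel₀ _ (hcount e₀ he₀).ne']

theorem exists_feasible_noFlowCycle (hno : ¬ ∃ C : List E, P.IsNegInftyCycle C) (f : E → ℝ≥0)
    (hf : P.IsFeasible f) :
    ∃ g : E → ℝ≥0, P.IsFeasible g ∧ P.totalCost g ≤ P.totalCost f ∧ P.NoFlowCycle g := by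
  induction hs : P.inftySupport f using Finset.strongInduction generalizing f with
  | H s ih =>
    subst hs
    by_cases h : P.NoFlowCycle f
    · exact ⟨f, hf, le_rfl, h⟩
    · unfold NoFlowCycle at h
      push Not at h
      obtain ⟨C, hC, hpos⟩ := h
      obtain ⟨g, hg, hgc, hgs⟩ := exists_inftySupport_ssubset hno hf hC hpos
      obtain ⟨k, hk, hkc, hkn⟩ := ih _ hgs g hg rfl
      exact ⟨k, hk, hkc.trans hgc, hkn⟩

/-! ### Bounding flows without positive cycles -/

open Classical in
/-- The vertex set, as a `Finset`. -/
noncomputable def vertexFinset (P : MinCostFlowProblem V E) : Finset V :=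
  P.edges.image P.first ∪ P.edges.image P.second

theorem mem_vertexFinset {v : V} : v ∈ P.vertexFinset ↔ v ∈ P.vertices := by
  classical
  simp only [vertexFinset, Finset.mem_union, Finset.mem_image, DiMultigraph.vertices,
    Set.mem_ofPred_eq]
  grind

/-- The sum of the absolute values of the balances and of the finite capacities
(`ENNReal.toReal` sends infinite capacities to `0`). -/
noncomputable def flowBound (P : MinCostFlowProblem V E) : ℝ :=
  ∑ v ∈ P.vertexFinset, |P.balance v| + ∑ e ∈ P.edges, (P.cap e).toReal

open Classical in
/-- The sum of the balances on a set of vertices is the flow on the leaving edges minus that on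
the entering edges. -/
theorem IsFeasible.sum_balance {f : E → ℝ≥0} (hf : P.IsFeasible f) {S : Finset V}
    (hS : ∀ v ∈ S, v ∈ P.vertices) :
    ∑ v ∈ S, P.balance v = ∑ e ∈ P.edges,
      ((if P.first e ∈ S then (f e : ℝ) else 0) - if P.second e ∈ S then (f e : ℝ) else 0) := by
  have hsum : ∀ h : E → V, ∑ v ∈ S, ∑ e ∈ P.edges with h e = v, (f e : ℝ) =
      ∑ e ∈ P.edges, if h e ∈ S then (f e : ℝ) else 0 := fun h => by
    simp only [Finset.sum_filter]
    rw [Finset.sum_comm]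
    simp
  rw [Finset.sum_sub_distrib, ← hsum, ← hsum, ← Finset.sum_sub_distrib]
  refine Finset.sum_congr rfl fun v hv => ?_
  rw [← hf.2 v (hS v hv), excess, neg_sub]
  rfl

theorem IsFeasible.le_toReal_cap {f : E → ℝ≥0} (hf : P.IsFeasible f) {e : E} (he : e ∈ P.edges)
    (hcap : P.cap e ≠ ∞) : (f e : ℝ) ≤ (P.cap e).toReal := by
  have := ENNReal.toReal_mono hcap (hf.1 e he)
  simpa using this

/-- The cut argument, for the set `S` of vertices from which the start of `e₀` is reachable along
infinite-capacity edges carrying flow. -/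
theorem IsFeasible.le_flowBound {f : E → ℝ≥0} (hf : P.IsFeasible f) (hac : P.NoFlowCycle f)
    {e₀ : E} (he₀ : e₀ ∈ P.edges) : (f e₀ : ℝ) ≤ P.flowBound := by
  classical
  have hbal : 0 ≤ ∑ v ∈ P.vertexFinset, |P.balance v| :=
    Finset.sum_nonneg fun v _ => abs_nonneg _
  have hcaps : 0 ≤ ∑ e ∈ P.edges, (P.cap e).toReal :=
    Finset.sum_nonneg fun e _ => ENNReal.toReal_nonneg
  by_cases hcap : P.cap e₀ = ∞
  swap
  · have h1 := hf.le_toReal_cap he₀ hcap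
    have h2 := Finset.single_le_sum (f := fun e => (P.cap e).toReal)
      (fun e _ => ENNReal.toReal_nonneg) he₀
    unfold flowBound
    linarith
  rcases eq_zero_or_pos (f e₀) with h0 | hpos
  · rw [h0, flowBound]
    push_cast
    linarith
  let R : V → V → Prop := fun a b =>
    ∃ e ∈ P.edges, (P.cap e = ∞ ∧ 0 < f e) ∧ P.first e = a ∧ P.second e = b
  let S : Finset V := {v ∈ P.vertexFinset | Relation.ReflTransGen R v (P.first e₀)}
  have hS : ∀ v ∈ S, v ∈ P.vertices := fun v hv => mem_vertexFinset.1 (Finset.mem_filter.1 hv).1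
  have hfirst : P.first e₀ ∈ S :=
    Finset.mem_filter.2 ⟨mem_vertexFinset.2 ⟨e₀, he₀, Or.inl rfl⟩, .refl⟩
  have hsecond : P.second e₀ ∉ S := fun h => by
    obtain ⟨p, hp, hpQ, hne, hhead, hlast⟩ := DiMultigraph.exists_isPath_of_reflTransGen
      (G := P.toDiMultigraph) (Q := fun e => P.cap e = ∞ ∧ 0 < f e) he₀ ⟨hcap, hpos⟩
      (Finset.mem_filter.1 h).2
    exact hac p ⟨hp, hne, hhead.trans hlast.symm⟩ hpQ
  have hclosed : ∀ e ∈ P.edges, P.cap e = ∞ → 0 < f e → P.second e ∈ S → P.first e ∈ S :=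
    fun e he hc hp h => Finset.mem_filter.2 ⟨mem_vertexFinset.2 ⟨e, he, Or.inl rfl⟩,
      .head ⟨e, he, ⟨hc, hp⟩, rfl, rfl⟩ (Finset.mem_filter.1 h).2⟩
  -- Of the net flow leaving `S`, `e₀` contributes its full value, and only edges of finite capacity
  -- can contribute negatively.
  have hterm : ∀ e ∈ P.edges, (if e = e₀ then (f e₀ : ℝ) else 0) - (P.cap e).toReal ≤
      (if P.first e ∈ S then (f e : ℝ) else 0) - if P.second e ∈ S then (f e : ℝ) else 0 := by
    intro e he
    have hnn := (f e).coe_nonneg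
    by_cases hee : e = e₀
    · subst hee
      simp [hfirst, hsecond, hcap]
    · by_cases hc : P.cap e = ∞
      · rcases eq_zero_or_pos (f e) with h0 | hp
        · simp [hee, hc, h0]
        · have := hclosed e he hc hp
          simp only [hee, hc, if_false, ENNReal.toReal_top]
          split_ifs <;> first | linarith | tauto
      · have := hf.le_toReal_cap he hc
        simp only [hee, if_false]
        split_ifs <;> linarith
  have hsum := Finset.sum_le_sum hterm
  rw [← hf.sum_balance hS, Finset.sum_sub_distrib, Finset.sum_ite_eq' P.edges e₀,
    if_pos he₀] at hsum
  have h1 : ∑ v ∈ S, P.balance v ≤ ∑ v ∈ P.vertexFinset, |P.balance v| :=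
    (Finset.sum_le_sum fun v _ => le_abs_self _).trans
      (Finset.sum_le_sum_of_subset_of_nonneg (Finset.filter_subset _ _)
        fun v _ _ => abs_nonneg _)
  unfold flowBound
  linarith

/-! ### Existence of an optimum -/

theorem continuous_totalCost (P : MinCostFlowProblem V E) : Continuous P.totalCost := by
  unfold totalCost
  fun_prop

theorem isClosed_setOf_isFeasible (P : MinCostFlowProblem V E) :
    IsClosed {f : E → ℝ≥0 | P.IsFeasible f} := by
  simp only [IsFeasible, Set.ofPred_and, Set.ofPred_forall]
  refine IsClosed.inter ?_ ?_
  · refine isClosed_biInter fun e _ => isClosed_le ?_ continuous_const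
    exact ENNReal.continuous_coe.comp (continuous_apply e)
  · refine isClosed_biInter fun v _ => isClosed_eq ?_ continuous_const
    unfold excess
    fun_prop

theorem exists_isOptimal (hno : ¬ ∃ C : List E, P.IsNegInftyCycle C)
    (hfeas : ∃ f : E → ℝ≥0, P.IsFeasible f) : ∃ f : E → ℝ≥0, P.IsOptimal f := by
  let B : ℝ≥0 := P.flowBound.toNNReal
  let K : Set (E → ℝ≥0) := Set.univ.pi (fun _ => Set.Icc 0 B) ∩ {f | P.IsFeasible f}
  have hK : IsCompact K :=
    (isCompact_univ_pi fun _ => isCompact_Icc).inter_right P.isClosed_setOf_isFeasible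
  have hred : ∀ f, P.IsFeasible f → ∃ g ∈ K, P.totalCost g ≤ P.totalCost f := fun f hf => by
    obtain ⟨g, hg, hgc, hac⟩ := exists_feasible_noFlowCycle hno f hf
    -- Values outside the edge set are irrelevant but unbounded; truncation only affects those.
    have heq : ∀ e ∈ P.edges, min (g e) B = g e := fun e he =>
      min_eq_left (NNReal.le_toNNReal_of_coe_le (hg.le_flowBound hac he))
    refine ⟨fun e => min (g e) B, ⟨fun e _ => ⟨zero_le, min_le_right _ _⟩, hg.congr heq⟩, ?_⟩
    refine le_of_eq_of_le ?_ hgc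
    exact Finset.sum_congr rfl fun e he => by simp only [heq e he]
  obtain ⟨f₀, hf₀⟩ := hfeas
  obtain ⟨g₀, hg₀, -⟩ := hred f₀ hf₀
  obtain ⟨f, hfK, hmin⟩ := hK.exists_isMinOn ⟨g₀, hg₀⟩ P.continuous_totalCost.continuousOn
  refine ⟨f, hfK.2, fun h hh => ?_⟩
  obtain ⟨g, hgK, hgc⟩ := hred h hh
  exact (hmin hgK).trans hgc

end MinCostFlowProblem

theorem mainTheorem11 {V E : Type*} (P : MinCostFlowProblem V E)
    (hfeas : ∃ f : E → ℝ≥0, P.IsFeasible f) :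
    ((∃ f : E → ℝ≥0, P.IsOptimal f) ↔ ¬ ∃ C : List E, P.IsNegInftyCycle C) ∧
    ((∃ C : List E, P.IsNegInftyCycle C) →
      ∀ K : ℝ, ∃ f : E → ℝ≥0, P.IsFeasible f ∧ P.totalCost f < K) := by
  refine ⟨⟨?_, fun hno => MinCostFlowProblem.exists_isOptimal hno hfeas⟩, ?_⟩
  · rintro ⟨f, hf, hopt⟩ ⟨C, hC⟩
    obtain ⟨g, hg, hlt⟩ := MinCostFlowProblem.exists_totalCost_lt hC hf (P.totalCost f)
    exact (hopt g hg).not_gt hlt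
  · rintro ⟨C, hC⟩ K
    obtain ⟨f, hf⟩ := hfeas
    exact MinCostFlowProblem.exists_totalCost_lt hC hf K
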